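/- Let $\mathscr A$ be an arbitrary (not necessarily unital) $C^*$-algebra and let $\mathscr X$ be a Hilbert $\mathscr A$-module with $\mathscr A$-valued inner product $\langle\cdot,\cdot\rangle$. For partially defined linear operators $s,t$ in $\mathscr X$, the product $st$ has domain $\{x\in\mathrm{Dom}(t): t(x)\in\mathrm{Dom}(s)\}$, and $t\subseteq s$ means that $s$ extends $t$. For a densely defined $t$, the adjoint $t^*$ has domain $\{y:\exists z\ \forall x\in \mathrm{Dom}(t),\ \langle t(x),y\rangle=\langle x,z\rangle\}$, and $t^*(y)=z$. An operator $t$ in $\mathscr X$ is called regular if it is $\mathscr A$-linear, densely defined and closed, $t^*$ is densely defined, and the range of $1+t^*t$ is dense in $\mathscr X$. A Moore–Penrose inverse of a regular operator $t$ is a regular operator $s$ such that $tst=t$, $sts=s$, $(ts)^*=\overline{ts}$ and $(st)^*=\overline{st}$. Let $t$ be a regular operator in $\mathscr X$ such that $\overline{\mathrm{Ran}(t^*)}$ and $\overline{\mathrm{Ran}(t)}$ are orthogonally complemented in $\mathscr X$, that is, $\mathscr X=\overline{\mathrm{Ran}(t^*)}\oplus\overline{\mathrm{Ran}(t^*)}^{\perp}$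 and $\mathscr X=\overline{\mathrm{Ran}(t)}\oplus\overline{\mathrm{Ran}(t)}^{\perp}$. Let $S:\mathscr X\to\mathscr X$ be a bounded adjointable operator that commutes with $t$ and with $t^*$, that is, $St\subseteq tS$ and $St^*\subseteq t^*S$. Then $t$ has a unique Moore–Penrose inverse $t^\dagger$, and $St^\dagger\subseteq t^\dagger S$. -/

import Mathlib

namespace HilbertModuleOperator

/-! Hilbert C*-modules are `CStarModule A X` with `X` complete; `A` is any C*-algebra, not necessarily
unital. The inner product is linear in the second variable, and `⟪x, a • y⟫ = a * ⟪x, y⟫`; a right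
Hilbert module over a C*-algebra `B` is the case `A = Bᵐᵒᵖ`. -/

section Defs

variable (A : Type*) {X Y Z : Type*}
  [NonUnitalCStarAlgebra A] [PartialOrder A] [StarOrderedRing A]
  [NormedAddCommGroup X] [NormedSpace ℂ X] [SMul A X] [CStarModule A X]
  [NormedAddCommGroup Y] [NormedSpace ℂ Y] [SMul A Y] [CStarModule A Y]
  [NormedAddCommGroup Z] [NormedSpace ℂ Z]

/-- The product `g f` of partially defined operators, with
`Dom (g f) = {x ∈ Dom f : f x ∈ Dom g}` and `(g f) x = g (f x)`. -/
def mulOp (g : Y →ₗ.[ℂ] Z) (f : X →ₗ.[ℂ] Y) : X →ₗ.[ℂ] Z where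
  domain :=
    { carrier := {x | ∃ hx : x ∈ f.domain, f ⟨x, hx⟩ ∈ g.domain}
      zero_mem' := ⟨f.domain.zero_mem, by
        have h : f ⟨0, f.domain.zero_mem⟩ = 0 := f.map_zero
        rw [h]
        exact g.domain.zero_mem⟩
      add_mem' := by
        rintro x y ⟨hx, hx'⟩ ⟨hy, hy'⟩
        refine ⟨f.domain.add_mem hx hy, ?_⟩
        have h : f ⟨x + y, f.domain.add_mem hx hy⟩ = f ⟨x, hx⟩ + f ⟨y, hy⟩ :=
          f.map_add ⟨x, hx⟩ ⟨y, hy⟩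
        rw [h]
        exact g.domain.add_mem hx' hy'
      smul_mem' := by
        rintro c x ⟨hx, hx'⟩
        refine ⟨f.domain.smul_mem c hx, ?_⟩
        have h : f ⟨c • x, f.domain.smul_mem c hx⟩ = c • f ⟨x, hx⟩ :=
          f.map_smul c ⟨x, hx⟩
        rw [h]
        exact g.domain.smul_mem c hx' }
  toFun :=
    { toFun := fun x => g ⟨f ⟨x, x.2.1⟩, x.2.2⟩
      map_add' := by
        intro x y
        rw [← LinearPMap.map_add]
        congr 1
        ext
        exact f.map_add ⟨x, x.2.1⟩ ⟨y, y.2.1⟩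
      map_smul' := by
        intro c x
        rw [RingHom.id_apply, ← LinearPMap.map_smul]
        congr 1
        ext
        exact f.map_smul c ⟨x, x.2.1⟩ }

/-- A bounded operator, seen as a partially defined operator with full domain. -/
def ofBounded (S : X →L[ℂ] Y) : X →ₗ.[ℂ] Y := (S : X →ₗ[ℂ] Y).toPMap ⊤

/-- `S` is adjointable: there is `T` with `⟪S x, y⟫ = ⟪x, T y⟫` for all `x`, `y`. -/
def IsAdjointable (S : X →L[ℂ] Y) : Prop :=
  ∃ T : Y → X, ∀ x y, inner A (S x) y = inner A x (T y)

/-- The orthogonal complement with respect to the `A`-valued inner product. -/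
def orthogonal (W : Submodule ℂ X) : Submodule ℂ X where
  carrier := {x | ∀ w ∈ W, inner A w x = 0}
  zero_mem' := fun w _ => CStarModule.inner_zero_right
  add_mem' := by
    intro x y hx hy w hw
    rw [CStarModule.inner_add_right, hx w hw, hy w hw, add_zero]
  smul_mem' := by
    intro c x hx w hw
    rw [CStarModule.inner_smul_right_complex, hx w hw, smul_zero]

/-- `W` is orthogonally complemented: `X = W ⊕ W^⊥`. -/
def IsOrthogonallyComplemented (W : Submodule ℂ X) : Prop :=
  IsCompl W (orthogonal A W)

/-- The pairs `(y, z)` with `⟪t x, y⟫ = ⟪x, z⟫` for all `x ∈ Dom t`. -/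
def adjointGraph (t : X →ₗ.[ℂ] Y) : Submodule ℂ (Y × X) where
  carrier := {p | ∀ x : t.domain, inner A (t x) p.1 = inner A (x : X) p.2}
  zero_mem' := fun x => by
    rw [Prod.fst_zero, Prod.snd_zero, CStarModule.inner_zero_right, CStarModule.inner_zero_right]
  add_mem' := by
    intro p q hp hq x
    rw [Prod.fst_add, Prod.snd_add, CStarModule.inner_add_right, CStarModule.inner_add_right,
      hp x, hq x]
  smul_mem' := by
    intro c p hp x
    rw [Prod.smul_fst, Prod.smul_snd, CStarModule.inner_smul_right_complex,
      CStarModule.inner_smul_right_complex, hp x]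

/-- The adjoint `t*` of a densely defined operator `t` (only meaningful for dense `Dom t`; see
`adjoint_graph`). Its domain is the set of all `y` for which some `z` satisfies
`⟪t x, y⟫ = ⟪x, z⟫` for all `x ∈ Dom t`, and `t* y = z`. -/
noncomputable def adjoint (t : X →ₗ.[ℂ] Y) : Y →ₗ.[ℂ] X :=
  (adjointGraph A t).toLinearPMap

/-- `t` is `A`-linear: `Dom t` is stable under `A` and `t (a x) = a (t x)`. -/
def IsModuleLinear (t : X →ₗ.[ℂ] Y) : Prop :=
  ∀ (a : A) (x : t.domain), ∃ h : a • (x : X) ∈ t.domain, t ⟨a • (x : X), h⟩ = a • t x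

/-- Regular operators: `A`-linear, densely defined, closed, adjointable (the adjoint is densely
defined), and such that `1 + t* t` has dense range. -/
structure IsRegular (t : X →ₗ.[ℂ] Y) : Prop where
  moduleLinear : IsModuleLinear A t
  dense_domain : Dense (t.domain : Set X)
  closed : t.IsClosed
  dense_adjoint_domain : Dense ((adjoint A t).domain : Set Y)
  dense_range : Dense (Set.range fun x : (mulOp (adjoint A t) t).domain =>
    (x : X) + mulOp (adjoint A t) t x)

/-- `s` is a Moore–Penrose inverse of the regular operator `t`: `s` is regular, `t s t = t`,
`s t s = s`, `(t s)* = closure (t s)` and `(s t)* = closure (s t)`. -/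
structure IsMoorePenroseInverse (t : X →ₗ.[ℂ] Y) (s : Y →ₗ.[ℂ] X) : Prop where
  regular : IsRegular A s
  mul_mul_self : mulOp t (mulOp s t) = t
  self_mul_mul : mulOp s (mulOp t s) = s
  adjoint_left : adjoint A (mulOp t s) = (mulOp t s).closure
  adjoint_right : adjoint A (mulOp s t) = (mulOp s t).closure

/-- `S` commutes with `t`: `S t ⊆ t S`. -/
def Commutes (S : X →L[ℂ] X) (t : X →ₗ.[ℂ] X) : Prop :=
  mulOp (ofBounded S) t ≤ mulOp t (ofBounded S)

variable {A}

/-- A vector orthogonal to a dense set of vectors is zero. -/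
theorem eq_zero_of_dense {D : Set X} (hD : Dense D) {z : X}
    (h : ∀ x ∈ D, inner A x z = 0) : z = 0 := by
  have hc : Continuous fun x : X => inner A x z := by
    have := CStarModule.continuous_inner (A := A) (E := X)
    exact this.comp (continuous_id.prodMk continuous_const)
  have h0 : (fun x : X => inner A x z) = fun _ => 0 := by
    exact hc.ext_on hD continuous_const h
  exact CStarModule.inner_self.mp (congrFun h0 z)

/-- For densely defined `t`, the graph of `adjoint A t` is `adjointGraph A t`. -/
theorem adjoint_graph {t : X →ₗ.[ℂ] Y} (ht : Dense (t.domain : Set X)) :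
    (adjoint A t).graph = adjointGraph A t := by
  refine Submodule.toLinearPMap_graph_eq _ ?_
  rintro ⟨y, z⟩ hp (rfl : y = 0)
  refine eq_zero_of_dense (A := A) ht fun x hx => ?_
  have h := hp ⟨x, hx⟩
  simpa using h.symm

end Defs

end HilbertModuleOperator

namespace HilbertModuleOperator

section Pinv

variable {A X Y Z : Type*}
  [NonUnitalCStarAlgebra A] [PartialOrder A]
  [NormedAddCommGroup X] [NormedSpace ℂ X] [SMul A X] [CStarModule A X]
  [NormedAddCommGroup Y] [NormedSpace ℂ Y] [SMul A Y] [CStarModule A Y]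
  [NormedAddCommGroup Z] [NormedSpace ℂ Z]

/-! Everything is done with graphs. Regularity makes the graph of `t` and the rotated graph of `t*`
span `X × Y` (`IsRegular.graphsSpan`); conversely such a decomposition gives closedness and the
density of `Ran (1 + t* t)` (`GraphsSpan.isRegular`). It also yields `t = t**`, hence `Ker t =
Ran(t*)^⊥`.

The inverse `t†` undoes `t` on the closure of `Ran t*` and kills `Ran(t)^⊥`. The two complements
make its domain dense and turn the decomposition for `t` into one for `t†`, so `t†` is regular
(`IsRegular.graphsSpan_pinv`). The products `t t†` and `t† t` are densely defined restrictions of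
orthogonal projections, which gives the adjoint identities.

For uniqueness, symmetry of `t s` and `s t` gives `s ⊆ t†`, and closedness of `s` shows that it
vanishes on `Ran(t)^⊥`. Finally `S` preserves each of the subspaces and graphs defining `t†`, hence
its graph. -/

theorem inner_comm_eq {x x' : X} {y y' : Y} (h : (inner A x x' : A) = inner A y y') :
    (inner A x' x : A) = inner A y' y := by
  rw [← CStarModule.star_inner x x', h, CStarModule.star_inner]

theorem mem_orthogonal {W : Submodule ℂ X} {x : X} :
    x ∈ orthogonal A W ↔ ∀ w ∈ W, inner A w x = 0 := Iff.rfl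

theorem inner_eq_zero_of_mem_orthogonal {W : Submodule ℂ X} {w x : X} (hw : w ∈ W)
    (hx : x ∈ orthogonal A W) : inner A x w = 0 := by
  rw [← CStarModule.star_inner w x, hx w hw, star_zero]

theorem IsOrthogonallyComplemented.exists_add {W : Submodule ℂ X}
    (hW : IsOrthogonallyComplemented A W) (x : X) :
    ∃ p ∈ W, ∃ n ∈ orthogonal A W, p + n = x :=
  Submodule.mem_sup.mp (hW.sup_eq_top ▸ Submodule.mem_top)

/-- This is `W^⊥⊥ ⊆ W`: the component of `x` in `W^⊥` is orthogonal to itself. -/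
theorem IsOrthogonallyComplemented.mem_of_inner_eq_zero {W : Submodule ℂ X}
    (hW : IsOrthogonallyComplemented A W) {x : X}
    (hx : ∀ n ∈ orthogonal A W, inner A n x = 0) : x ∈ W := by
  obtain ⟨p, hp, n, hn, rfl⟩ := hW.exists_add x
  have h := hx n hn
  rw [CStarModule.inner_add_right, inner_eq_zero_of_mem_orthogonal hp hn, zero_add,
    CStarModule.inner_self] at h
  rwa [h, add_zero]

/-- Pythagoras in `X × Y`: the hypothesis says that `(x, z)` and `(-w, y)` are orthogonal. -/
theorem inner_self_sub_add_inner_self_add {x w : X} {y z : Y}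
    (h : (inner A z y : A) = inner A x w) :
    (inner A (x - w) (x - w) + inner A (z + y) (z + y) : A) =
      inner A x x + inner A w w + (inner A z z + inner A y y) := by
  have h' := inner_comm_eq h
  simp only [CStarModule.inner_sub_left, CStarModule.inner_sub_right, CStarModule.inner_add_left,
    CStarModule.inner_add_right, h, h']
  abel

theorem eq_zero_of_mem_of_mem_orthogonal {W : Submodule ℂ X} {x : X} (hx : x ∈ W)
    (hx' : x ∈ orthogonal A W) : x = 0 :=
  CStarModule.inner_self.mp (hx' x hx)

theorem inner_eq_of_sub_mem_orthogonal {W : Submodule ℂ X} {p x y : X} (hp : p ∈ W)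
    (h : x - y ∈ orthogonal A W) : (inner A p x : A) = inner A p y :=
  sub_eq_zero.mp (by rw [← CStarModule.inner_sub_right, h p hp])

/-! ### Products as composition of graphs; the identities `t s t = t` and `s t s = s` -/

theorem mem_mulOp_graph {g : Y →ₗ.[ℂ] Z} {f : X →ₗ.[ℂ] Y} {x : X} {z : Z} :
    (x, z) ∈ (mulOp g f).graph ↔ ∃ y, (x, y) ∈ f.graph ∧ (y, z) ∈ g.graph := by
  constructor
  · intro h
    obtain ⟨⟨x, hx, hfx⟩, rfl, rfl⟩ := (LinearPMap.mem_graph_iff _).mp h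
    exact ⟨f ⟨x, hx⟩, f.mem_graph ⟨x, hx⟩, g.mem_graph ⟨_, hfx⟩⟩
  · rintro ⟨y, hf, hg⟩
    obtain ⟨x, rfl, rfl⟩ := (LinearPMap.mem_graph_iff _).mp hf
    obtain ⟨y, hy, rfl⟩ := (LinearPMap.mem_graph_iff _).mp hg
    have hfx : f x ∈ g.domain := by
      rw [← show (y : Y) = f x from hy]
      exact y.2
    refine (LinearPMap.mem_graph_iff _).mpr ⟨⟨x, x.2, hfx⟩, rfl, ?_⟩
    change g ⟨f x, hfx⟩ = g y
    congr 1
    exact Subtype.ext hy.symm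

theorem IsMoorePenroseInverse.mem_graph_mul {t : X →ₗ.[ℂ] Y} {s : Y →ₗ.[ℂ] X}
    (hs : IsMoorePenroseInverse A t s) {x : X} {z : Y} (hxz : (x, z) ∈ t.graph) :
    ∃ p, (z, p) ∈ s.graph ∧ (p, z) ∈ t.graph := by
  have h := hxz
  rw [← hs.mul_mul_self] at h
  obtain ⟨p, h1, h2⟩ := mem_mulOp_graph.mp h
  obtain ⟨z', h3, h4⟩ := mem_mulOp_graph.mp h1
  rw [LinearPMap.mem_graph_snd_inj _ h3 hxz rfl] at h4
  exact ⟨p, h4, h2⟩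

theorem IsMoorePenroseInverse.mul_mem_graph {t : X →ₗ.[ℂ] Y} {s : Y →ₗ.[ℂ] X}
    (hs : IsMoorePenroseInverse A t s) {y : Y} {x : X} (hyx : (y, x) ∈ s.graph) :
    ∃ z, (x, z) ∈ t.graph ∧ (z, x) ∈ s.graph := by
  have h := hyx
  rw [← hs.self_mul_mul] at h
  obtain ⟨z, h1, h2⟩ := mem_mulOp_graph.mp h
  obtain ⟨x', h3, h4⟩ := mem_mulOp_graph.mp h1
  rw [LinearPMap.mem_graph_snd_inj _ h3 hyx rfl] at h4
  exact ⟨z, h4, h2⟩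

theorem IsMoorePenroseInverse.dense_domain_left {t : X →ₗ.[ℂ] Y} {s : Y →ₗ.[ℂ] X}
    (hs : IsMoorePenroseInverse A t s) : Dense ((mulOp t s).domain : Set Y) := by
  refine hs.regular.dense_domain.mono fun y hy => ?_
  obtain ⟨x, hyx⟩ := LinearPMap.mem_domain_iff.mp hy
  obtain ⟨z, h1, -⟩ := hs.mul_mem_graph hyx
  exact LinearPMap.mem_domain_iff.mpr ⟨z, mem_mulOp_graph.mpr ⟨x, hyx, h1⟩⟩

theorem IsMoorePenroseInverse.dense_domain_right {t : X →ₗ.[ℂ] Y} {s : Y →ₗ.[ℂ] X}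
    (hs : IsMoorePenroseInverse A t s) (ht : Dense (t.domain : Set X)) :
    Dense ((mulOp s t).domain : Set X) := by
  refine ht.mono fun x hx => ?_
  obtain ⟨z, hxz⟩ := LinearPMap.mem_domain_iff.mp hx
  obtain ⟨p, h1, -⟩ := hs.mem_graph_mul hxz
  exact LinearPMap.mem_domain_iff.mpr ⟨p, mem_mulOp_graph.mpr ⟨z, hxz, h1⟩⟩

variable [StarOrderedRing A]

/-! ### Continuity of the inner product; commutation, linearity and adjoints via graphs -/

theorem continuous_inner_left (y : X) : Continuous fun x : X => (inner A x y : A) :=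
  (CStarModule.continuous_inner (A := A) (E := X)).comp (continuous_id.prodMk continuous_const)

theorem continuous_inner_right (x : X) : Continuous fun y : X => (inner A x y : A) :=
  (CStarModule.continuous_inner (A := A) (E := X)).comp (continuous_const.prodMk continuous_id)

theorem orthogonal_topologicalClosure (W : Submodule ℂ X) :
    orthogonal A W.topologicalClosure = orthogonal A W := by
  ext x
  refine ⟨fun h w hw => h w (W.le_topologicalClosure hw), fun h w hw => ?_⟩
  have hc : IsClosed {w : X | (inner A w x : A) = 0} :=
    isClosed_eq (continuous_inner_left x) continuous_const
  exact closure_minimal (s := (W : Set X)) (fun w hw => h w hw) hc hw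

theorem mem_ofBounded_graph {S : X →L[ℂ] Y} {x : X} {y : Y} :
    (x, y) ∈ (ofBounded S).graph ↔ S x = y := by
  rw [LinearPMap.mem_graph_iff]
  constructor
  · rintro ⟨x', rfl, h⟩
    exact h
  · rintro h
    exact ⟨⟨x, Submodule.mem_top⟩, rfl, h⟩

theorem commutes_iff {S : X →L[ℂ] X} {t : X →ₗ.[ℂ] X} :
    Commutes S t ↔ ∀ x y, (x, y) ∈ t.graph → (S x, S y) ∈ t.graph := by
  rw [Commutes, ← LinearPMap.le_graph_iff]
  constructor
  · intro h x y hxy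
    obtain ⟨z, hz, hz'⟩ := mem_mulOp_graph.mp
      (h (mem_mulOp_graph.mpr ⟨y, hxy, mem_ofBounded_graph.mpr rfl⟩))
    rwa [mem_ofBounded_graph.mp hz]
  · rintro h ⟨x, z⟩ hxz
    obtain ⟨y, hxy, hyz⟩ := mem_mulOp_graph.mp hxz
    rw [← mem_ofBounded_graph.mp hyz]
    exact mem_mulOp_graph.mpr ⟨S x, mem_ofBounded_graph.mpr rfl, h x y hxy⟩

theorem isModuleLinear_iff {t : X →ₗ.[ℂ] Y} :
    IsModuleLinear A t ↔ ∀ (a : A) (x : X) (y : Y), (x, y) ∈ t.graph → (a • x, a • y) ∈ t.graph := by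
  constructor
  · intro h a x y hxy
    obtain ⟨x, rfl, rfl⟩ := (LinearPMap.mem_graph_iff _).mp hxy
    obtain ⟨hx, hx'⟩ := h a x
    exact (LinearPMap.mem_graph_iff _).mpr ⟨⟨_, hx⟩, rfl, hx'⟩
  · intro h a x
    obtain ⟨x', hx, hx'⟩ := (LinearPMap.mem_graph_iff _).mp (h a _ _ (t.mem_graph x))
    have hm : a • (x : X) ∈ t.domain := by
      rw [← show (x' : X) = a • (x : X) from hx]
      exact x'.2
    refine ⟨hm, Eq.trans ?_ hx'⟩
    congr 1
    exact Subtype.ext hx.symm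

theorem mem_range_iff {t : X →ₗ.[ℂ] Y} {y : Y} :
    y ∈ LinearMap.range t.toFun ↔ ∃ x, (x, y) ∈ t.graph := by
  rw [← LinearPMap.graph_map_snd_eq_range]
  simp only [Submodule.mem_map, Prod.exists, LinearMap.snd_apply, exists_eq_right]

theorem mem_adjoint_graph {t : X →ₗ.[ℂ] Y} (ht : Dense (t.domain : Set X)) {y : Y} {w : X} :
    (y, w) ∈ (adjoint A t).graph ↔ ∀ x z, (x, z) ∈ t.graph → (inner A z y : A) = inner A x w := by
  rw [adjoint_graph ht]
  constructor
  · intro h x z hxz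
    obtain ⟨x, rfl, rfl⟩ := (LinearPMap.mem_graph_iff _).mp hxz
    exact h x
  · intro h x
    exact h _ _ (t.mem_graph x)

theorem mem_orthogonal_range_iff {t : X →ₗ.[ℂ] Y} (ht : Dense (t.domain : Set X)) {y : Y} :
    y ∈ orthogonal A (LinearMap.range t.toFun) ↔ (y, 0) ∈ (adjoint A t).graph := by
  simp only [mem_adjoint_graph ht, mem_orthogonal, mem_range_iff, CStarModule.inner_zero_right]
  exact ⟨fun h x z hxz => h z ⟨x, hxz⟩, fun h z ⟨x, hxz⟩ => h x z hxz⟩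

theorem adjoint_isClosed {t : X →ₗ.[ℂ] Y} (ht : Dense (t.domain : Set X)) :
    (adjoint A t).IsClosed := by
  have h : ((adjoint A t).graph : Set (Y × X)) =
      ⋂ x : t.domain, {p | (inner A (t x) p.1 : A) = inner A (x : X) p.2} := by
    rw [adjoint_graph ht]
    ext p
    simp only [Set.mem_iInter]
    rfl
  rw [LinearPMap.IsClosed, h]
  exact isClosed_iInter fun x => isClosed_eq ((continuous_inner_right _).comp continuous_fst)
    ((continuous_inner_right _).comp continuous_snd)

/-! ### Regularity as an orthogonal decomposition of `X × Y` -/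

/-- Every pair `(u, v)` is the sum of an element `(x, t x)` of the graph of `t` and an element
`(-t* y, y)` of the rotated graph of `t*`. -/
def GraphsSpan (A : Type*) {X Y : Type*}
    [NonUnitalCStarAlgebra A] [PartialOrder A] [StarOrderedRing A]
    [NormedAddCommGroup X] [NormedSpace ℂ X] [SMul A X] [CStarModule A X]
    [NormedAddCommGroup Y] [NormedSpace ℂ Y] [SMul A Y] [CStarModule A Y]
    (t : X →ₗ.[ℂ] Y) : Prop :=
  ∀ (u : X) (v : Y), ∃ x z y w, (x, z) ∈ t.graph ∧ (y, w) ∈ (adjoint A t).graph ∧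
    u = x - w ∧ v = z + y

theorem norm_le_of_inner_self_le {x : X} {c : A} (h : (inner A x x : A) ≤ c) :
    ‖x‖ ^ 2 ≤ ‖c‖ := by
  rw [CStarModule.norm_sq_eq A]
  exact CStarAlgebra.norm_le_norm_of_nonneg_of_le CStarModule.inner_self_nonneg h

/-- By Pythagoras each of the four squares is dominated in `A` by a sum of norm at most `2 m ^ 2`,
and the norm is monotone on positive elements. The constant 2 is not sharp; it only has to bound the
sum map below. -/
theorem norm_le_of_orthogonal {x w : X} {y z : Y} (h : (inner A z y : A) = inner A x w) :
    max (max ‖x‖ ‖z‖) (max ‖y‖ ‖w‖) ≤ 2 * max ‖x - w‖ ‖z + y‖ := by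
  set m := max ‖x - w‖ ‖z + y‖
  have hm : ‖(inner A (x - w) (x - w) + inner A (z + y) (z + y) : A)‖ ≤ (2 * m) ^ 2 := by
    refine (norm_add_le _ _).trans ?_
    rw [← CStarModule.norm_sq_eq A, ← CStarModule.norm_sq_eq A]
    have h1 : ‖x - w‖ ^ 2 ≤ m ^ 2 := pow_le_pow_left₀ (norm_nonneg _) (le_max_left _ _) 2
    have h2 : ‖z + y‖ ^ 2 ≤ m ^ 2 := pow_le_pow_left₀ (norm_nonneg _) (le_max_right _ _) 2
    nlinarith [sq_nonneg m]
  rw [inner_self_sub_add_inner_self_add h] at hm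
  have hm0 : 0 ≤ 2 * m := by positivity
  have hx : (0 : A) ≤ inner A x x := CStarModule.inner_self_nonneg
  have hw : (0 : A) ≤ inner A w w := CStarModule.inner_self_nonneg
  have hz : (0 : A) ≤ inner A z z := CStarModule.inner_self_nonneg
  have hy : (0 : A) ≤ inner A y y := CStarModule.inner_self_nonneg
  refine max_le (max_le ?_ ?_) (max_le ?_ ?_) <;>
    refine le_of_sq_le_sq ((norm_le_of_inner_self_le (A := A) ?_).trans hm) hm0
  · exact (le_add_of_nonneg_right hw).trans (le_add_of_nonneg_right (add_nonneg hz hy))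
  · exact (le_add_of_nonneg_right hy).trans (le_add_of_nonneg_left (add_nonneg hx hw))
  · exact (le_add_of_nonneg_left hz).trans (le_add_of_nonneg_left (add_nonneg hx hw))
  · exact (le_add_of_nonneg_left hx).trans (le_add_of_nonneg_right (add_nonneg hz hy))

/-- The map `((x, z), (y, w)) ↦ (x - w, z + y)`. -/
def subAddCLM (X Y : Type*) [NormedAddCommGroup X] [NormedSpace ℂ X]
    [NormedAddCommGroup Y] [NormedSpace ℂ Y] : (X × Y) × (Y × X) →L[ℂ] X × Y :=
  ((ContinuousLinearMap.fst ℂ X Y).comp (ContinuousLinearMap.fst ℂ _ _) -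
      (ContinuousLinearMap.snd ℂ Y X).comp (ContinuousLinearMap.snd ℂ _ _)).prod
    ((ContinuousLinearMap.snd ℂ X Y).comp (ContinuousLinearMap.fst ℂ _ _) +
      (ContinuousLinearMap.fst ℂ Y X).comp (ContinuousLinearMap.snd ℂ _ _))

/-- The sum map on the product of the two closed graphs is bounded below, and its source is
complete, so its range is closed. -/
theorem isClosed_graph_add_adjoint_graph [CompleteSpace X] [CompleteSpace Y] {t : X →ₗ.[ℂ] Y}
    (ht : Dense (t.domain : Set X)) (hc : t.IsClosed) :
    IsClosed {p : X × Y | ∃ x z y w, (x, z) ∈ t.graph ∧ (y, w) ∈ (adjoint A t).graph ∧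
      p.1 = x - w ∧ p.2 = z + y} := by
  let W : Submodule ℂ ((X × Y) × (Y × X)) := t.graph.prod (adjoint A t).graph
  have hW : IsClosed (W : Set ((X × Y) × (Y × X))) := by
    have := IsClosed.prod hc (adjoint_isClosed (A := A) ht)
    rwa [← Submodule.prod_coe] at this
  have : CompleteSpace W := hW.completeSpace_coe
  let L : W →L[ℂ] X × Y := (subAddCLM X Y).comp W.subtypeL
  have hL : AntilipschitzWith 2 L := by
    refine ContinuousLinearMap.antilipschitz_of_bound _ ?_
    rintro ⟨⟨⟨x, z⟩, ⟨y, w⟩⟩, hp, hq⟩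
    exact norm_le_of_orthogonal ((mem_adjoint_graph ht).mp hq x z hp)
  have h : Set.range L = {p : X × Y | ∃ x z y w, (x, z) ∈ t.graph ∧
      (y, w) ∈ (adjoint A t).graph ∧ p.1 = x - w ∧ p.2 = z + y} := by
    refine Set.ext fun ⟨u, v⟩ => Iff.symm ?_
    constructor
    · rintro ⟨x, z, y, w, hp, hq, hu, hv⟩
      exact ⟨⟨⟨⟨x, z⟩, ⟨y, w⟩⟩, hp, hq⟩, (Prod.ext hu hv).symm⟩
    · rintro ⟨⟨⟨⟨x, z⟩, ⟨y, w⟩⟩, hp, hq⟩, h⟩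
      exact ⟨x, z, y, w, hp, hq, (congrArg Prod.fst h).symm, (congrArg Prod.snd h).symm⟩
  rw [← h]
  exact hL.isClosed_range L.uniformContinuous

/-- The sum of the graphs is closed, so it suffices to reach a dense set of pairs `(u, 0)`, using
`Ran (1 + t* t)`, and then of pairs `(0, v)`, using `Dom t*`. -/
theorem IsRegular.graphsSpan [CompleteSpace X] [CompleteSpace Y] {t : X →ₗ.[ℂ] Y}
    (ht : IsRegular A t) : GraphsSpan A t := by
  have hD := isClosed_graph_add_adjoint_graph (A := A) ht.dense_domain ht.closed
  set D : Set (X × Y) := {p : X × Y | ∃ x z y w, (x, z) ∈ t.graph ∧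
    (y, w) ∈ (adjoint A t).graph ∧ p.1 = x - w ∧ p.2 = z + y} with hDdef
  have hadd : ∀ {p q}, p ∈ D → q ∈ D → p + q ∈ D := by
    rintro p q ⟨x, z, y, w, h1, h2, h3, h4⟩ ⟨x', z', y', w', h1', h2', h3', h4'⟩
    refine ⟨x + x', z + z', y + y', w + w', t.graph.add_mem h1 h1',
      (adjoint A t).graph.add_mem h2 h2', ?_, ?_⟩
    · rw [Prod.fst_add, h3, h3']
      abel
    · rw [Prod.snd_add, h4, h4']
      abel
  have hneg : ∀ {p}, p ∈ D → -p ∈ D := by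
    rintro p ⟨x, z, y, w, h1, h2, h3, h4⟩
    refine ⟨-x, -z, -y, -w, t.graph.neg_mem h1, (adjoint A t).graph.neg_mem h2, ?_, ?_⟩
    · rw [Prod.fst_neg, h3]
      abel
    · rw [Prod.snd_neg, h4]
      abel
  have hleft : ∀ u : X, (u, (0 : Y)) ∈ D := by
    intro u
    have hcl : IsClosed {u : X | (u, (0 : Y)) ∈ D} :=
      hD.preimage (continuous_id.prodMk continuous_const)
    have hsub : (Set.range fun x : (mulOp (adjoint A t) t).domain =>
        (x : X) + mulOp (adjoint A t) t x) ⊆ {u : X | (u, (0 : Y)) ∈ D} := by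
      rintro _ ⟨x, rfl⟩
      obtain ⟨y, h1, h2⟩ := mem_mulOp_graph.mp ((mulOp (adjoint A t) t).mem_graph x)
      -- Here `(x + t* t x, 0) = (x, t x) + (t* t x, -t x)`.
      refine ⟨_, _, -y, -_, h1, (adjoint A t).graph.neg_mem h2, ?_, ?_⟩
      · simp
      · simp
    exact closure_minimal hsub hcl (ht.dense_range u)
  have hright : ∀ v : Y, ((0 : X), v) ∈ D := by
    intro v
    have hcl : IsClosed {v : Y | ((0 : X), v) ∈ D} :=
      hD.preimage (continuous_const.prodMk continuous_id)
    refine closure_minimal ?_ hcl (ht.dense_adjoint_domain v)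
    intro y hy
    obtain ⟨w, hw⟩ := LinearPMap.mem_domain_iff.mp hy
    have h1 : (-w, y) ∈ D :=
      ⟨0, 0, y, w, t.graph.zero_mem, hw, by simp, by simp⟩
    simpa using hadd h1 (hleft w)
  intro u v
  have h : (u, v) ∈ D := by
    simpa only [Prod.mk_add_mk, add_zero, zero_add] using hadd (hleft u) (hright v)
  exact h

/-- This is `t = t**`. The rotated component `(-w, y)` of `(x, z)` is orthogonal to itself, so the
positive elements `⟪y, y⟫` and `⟪w, w⟫` sum to zero and both vanish. -/
theorem GraphsSpan.mem_graph_iff {t : X →ₗ.[ℂ] Y} (hD : GraphsSpan A t)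
    (ht : Dense (t.domain : Set X)) {x : X} {z : Y} :
    (x, z) ∈ t.graph ↔
      ∀ y w, (y, w) ∈ (adjoint A t).graph → (inner A w x : A) = inner A y z := by
  constructor
  · intro h y w hyw
    exact inner_comm_eq ((mem_adjoint_graph ht).mp hyw x z h).symm
  · intro h
    obtain ⟨x', z', y, w, h1, h2, hu, hv⟩ := hD x z
    have h3 := h y w h2
    have h4 := inner_comm_eq ((mem_adjoint_graph ht).mp h2 x' z' h1).symm
    rw [hu, hv, CStarModule.inner_sub_right, CStarModule.inner_add_right, h4] at h3
    have h5 : (inner A y y : A) + inner A w w = 0 := by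
      have : (inner A y y : A) = -inner A w w := by
        rw [sub_eq_add_neg] at h3
        exact (add_left_cancel h3).symm
      rw [this, neg_add_cancel]
    have hy := (add_eq_zero_iff_of_nonneg (CStarModule.inner_self_nonneg (x := y))
      (CStarModule.inner_self_nonneg (x := w))).mp h5
    rw [CStarModule.inner_self, CStarModule.inner_self] at hy
    rwa [hu, hv, hy.1, hy.2, sub_zero, add_zero]

theorem GraphsSpan.isRegular {t : X →ₗ.[ℂ] Y} (hD : GraphsSpan A t) (hA : IsModuleLinear A t)
    (ht : Dense (t.domain : Set X)) (ht' : Dense ((adjoint A t).domain : Set Y)) :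
    IsRegular A t where
  moduleLinear := hA
  dense_domain := ht
  closed := by
    have h : (t.graph : Set (X × Y)) = ⋂ q : (adjoint A t).graph,
        {p | (inner A q.1.2 p.1 : A) = inner A q.1.1 p.2} := by
      ext ⟨x, z⟩
      simp only [Set.mem_iInter, SetLike.mem_coe, hD.mem_graph_iff ht, Set.mem_ofPred_eq,
        Subtype.forall, Prod.forall]
    rw [LinearPMap.IsClosed, h]
    exact isClosed_iInter fun x => isClosed_eq ((continuous_inner_right _).comp continuous_fst)
      ((continuous_inner_right _).comp continuous_snd)
  dense_adjoint_domain := ht'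
  dense_range := by
    intro u
    refine subset_closure ?_
    -- The second coordinate 0 forces `y = -t x`, so `u = x + t* t x`: the range is everything.
    obtain ⟨x, z, y, w, h1, h2, hu, hv⟩ := hD u 0
    have hz : (z, -w) ∈ (adjoint A t).graph := by
      rw [eq_neg_of_add_eq_zero_left hv.symm]
      exact (adjoint A t).graph.neg_mem h2
    obtain ⟨x', hx, hx'⟩ := (LinearPMap.mem_graph_iff _).mp (mem_mulOp_graph.mpr ⟨z, h1, hz⟩)
    refine ⟨x', ?_⟩
    change (x' : X) + mulOp (adjoint A t) t x' = u
    rw [hx, hx', hu, sub_eq_add_neg]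

theorem mem_orthogonal_range_adjoint_iff {t : X →ₗ.[ℂ] Y} (hD : GraphsSpan A t)
    (ht : Dense (t.domain : Set X)) {x : X} :
    x ∈ orthogonal A (LinearMap.range (adjoint A t).toFun) ↔ (x, 0) ∈ t.graph := by
  simp only [hD.mem_graph_iff ht, mem_orthogonal, mem_range_iff, CStarModule.inner_zero_right]
  exact ⟨fun h y w hyw => h w ⟨y, hyw⟩, fun h w ⟨y, hyw⟩ => h y w hyw⟩

/-! ### Construction and regularity of the Moore–Penrose inverse -/

/-- The pairs `(y, x)` with `x ∈ W ∩ Dom t` such that `y - t x` is orthogonal to the range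
of `t`. -/
def pinvGraph (A : Type*) {X Y : Type*} [NonUnitalCStarAlgebra A] [PartialOrder A]
    [NormedAddCommGroup X] [NormedSpace ℂ X]
    [NormedAddCommGroup Y] [NormedSpace ℂ Y] [SMul A Y] [CStarModule A Y]
    (t : X →ₗ.[ℂ] Y) (W : Submodule ℂ X) : Submodule ℂ (Y × X) where
  carrier := {p | p.2 ∈ W ∧ ∃ z, (p.2, z) ∈ t.graph ∧
    p.1 - z ∈ orthogonal A (LinearMap.range t.toFun)}
  zero_mem' := ⟨W.zero_mem, 0, t.graph.zero_mem, by
    rw [Prod.fst_zero, sub_zero]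
    exact Submodule.zero_mem _⟩
  add_mem' := by
    rintro p q ⟨hp, z, hz, hpz⟩ ⟨hq, z', hz', hqz'⟩
    refine ⟨W.add_mem hp hq, z + z', t.graph.add_mem hz hz', ?_⟩
    rw [Prod.fst_add, add_sub_add_comm]
    exact Submodule.add_mem _ hpz hqz'
  smul_mem' := by
    rintro c p ⟨hp, z, hz, hpz⟩
    refine ⟨W.smul_mem c hp, c • z, t.graph.smul_mem c hz, ?_⟩
    rw [Prod.smul_fst, ← smul_sub]
    exact Submodule.smul_mem _ c hpz

theorem mem_pinvGraph {t : X →ₗ.[ℂ] Y} {W : Submodule ℂ X} {y : Y} {x : X} :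
    (y, x) ∈ pinvGraph A t W ↔ x ∈ W ∧ ∃ z, (x, z) ∈ t.graph ∧
      y - z ∈ orthogonal A (LinearMap.range t.toFun) := Iff.rfl

/-- The domain contains `Ran t`, because `X = W + Ker t`, and also `Ran(t)^⊥`. With `W` left
general, the lemma serves both `t` and `t*`. -/
theorem dense_map_fst_pinvGraph {t : X →ₗ.[ℂ] Y} {W : Submodule ℂ X}
    (hW : ∀ x, ∃ p ∈ W, ∃ n, (n, (0 : Y)) ∈ t.graph ∧ p + n = x)
    (hran : IsOrthogonallyComplemented A (LinearMap.range t.toFun).topologicalClosure) :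
    Dense ((pinvGraph A t W).map (LinearMap.fst ℂ Y X) : Set Y) := by
  set D := (pinvGraph A t W).map (LinearMap.fst ℂ Y X)
  have h1 : LinearMap.range t.toFun ≤ D := by
    intro y hy
    obtain ⟨x, hx⟩ := mem_range_iff.mp hy
    obtain ⟨p, hp, n, hn, rfl⟩ := hW x
    refine ⟨(y, p), ⟨hp, y, ?_, ?_⟩, rfl⟩
    · simpa only [Prod.mk_sub_mk, add_sub_cancel_right, sub_zero] using t.graph.sub_mem hx hn
    · rw [sub_self]
      exact Submodule.zero_mem _
  have h2 : orthogonal A (LinearMap.range t.toFun).topologicalClosure ≤ D := by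
    intro y hy
    rw [orthogonal_topologicalClosure] at hy
    refine ⟨(y, 0), ⟨W.zero_mem, 0, t.graph.zero_mem, ?_⟩, rfl⟩
    rwa [sub_zero]
  have h3 : (⊤ : Submodule ℂ Y) ≤ D.topologicalClosure := by
    rw [← hran.sup_eq_top]
    exact sup_le (Submodule.topologicalClosure_mono h1) (h2.trans D.le_topologicalClosure)
  exact fun y => h3 (Submodule.mem_top (x := y))

/-- The Moore–Penrose inverse of `t`: it has domain `Ran t + (Ran t)^⊥`, vanishes on `(Ran t)^⊥`,
and inverts the restriction of `t` to the closure of `Ran t*`. -/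
noncomputable def pinv (A : Type*) {X Y : Type*} [NonUnitalCStarAlgebra A] [PartialOrder A]
    [NormedAddCommGroup X] [NormedSpace ℂ X] [SMul A X] [CStarModule A X]
    [NormedAddCommGroup Y] [NormedSpace ℂ Y] [SMul A Y] [CStarModule A Y]
    (t : X →ₗ.[ℂ] Y) : Y →ₗ.[ℂ] X :=
  (pinvGraph A t (LinearMap.range (adjoint A t).toFun).topologicalClosure).toLinearPMap

section Regular

variable {t : X →ₗ.[ℂ] Y}

theorem norm_le_of_mem_of_sub_mem_orthogonal {W : Submodule ℂ X} {x y : X} (hy : y ∈ W)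
    (h : x - y ∈ orthogonal A W) : ‖y‖ ≤ ‖x‖ := by
  refine le_of_sq_le_sq ?_ (norm_nonneg x)
  rw [CStarModule.norm_sq_eq A (x := x)]
  refine norm_le_of_inner_self_le ?_
  have h1 : (inner A x x : A) = inner A y y + inner A (x - y) (x - y) := by
    conv_lhs => rw [← add_sub_cancel y x]
    rw [CStarModule.inner_add_left, CStarModule.inner_add_right, CStarModule.inner_add_right,
      h y hy, inner_eq_zero_of_mem_orthogonal hy h, add_zero, zero_add]
  rw [h1]
  exact le_add_of_nonneg_right CStarModule.inner_self_nonneg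

theorem IsRegular.mem_orthogonal_range_iff (ht : IsRegular A t) {y : Y} :
    y ∈ orthogonal A (LinearMap.range t.toFun).topologicalClosure ↔
      (y, 0) ∈ (adjoint A t).graph := by
  rw [orthogonal_topologicalClosure,
    HilbertModuleOperator.mem_orthogonal_range_iff ht.dense_domain]

/-- A densely defined restriction of the orthogonal projection onto `W` has its adjoint equal to
its closure. -/
theorem adjoint_eq_closure_of_projection {W : Submodule ℂ X}
    (hW : IsOrthogonallyComplemented A W) {f : X →ₗ.[ℂ] X} (hf : Dense (f.domain : Set X))
    (h : ∀ x y, (x, y) ∈ f.graph → y ∈ W ∧ x - y ∈ orthogonal A W) :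
    adjoint A f = f.closure := by
  have hle : ∀ y w, w ∈ W → y - w ∈ orthogonal A W → (y, w) ∈ (adjoint A f).graph := by
    refine fun y w hw hyw => (mem_adjoint_graph hf).mpr fun x z hxz => ?_
    obtain ⟨hz, hxz⟩ := h x z hxz
    rw [inner_eq_of_sub_mem_orthogonal hz hyw]
    exact (inner_comm_eq (inner_eq_of_sub_mem_orthogonal hw hxz)).symm
  have hge : ∀ y w, (y, w) ∈ (adjoint A f).graph → w ∈ W ∧ y - w ∈ orthogonal A W := by
    intro y w hyw
    obtain ⟨p, hp, n, hn, rfl⟩ := hW.exists_add y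
    have hn' : p + n - p ∈ orthogonal A W := by rwa [add_sub_cancel_left]
    rw [(adjoint A f).mem_graph_snd_inj hyw (hle _ p hp hn') rfl]
    exact ⟨hp, hn'⟩
  have hfa : f.graph ≤ (adjoint A f).graph := fun ⟨x, y⟩ hxy => hle x y (h x y hxy).1 (h x y hxy).2
  have hfc : f.IsClosable :=
    (adjoint_isClosed hf).isClosable.leIsClosable (LinearPMap.le_of_le_graph hfa)
  refine LinearPMap.eq_of_eq_graph (le_antisymm ?_ ?_)
  · rw [← hfc.graph_closure_eq_closure_graph]
    rintro ⟨y, w⟩ hyw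
    obtain ⟨hw, hyw⟩ := hge y w hyw
    refine Metric.mem_closure_iff.mpr fun ε hε => ?_
    obtain ⟨x, hx, hxy⟩ := Metric.mem_closure_iff.mp (hf y) ε hε
    refine ⟨_, f.mem_graph ⟨x, hx⟩, ?_⟩
    obtain ⟨hz, hxz⟩ := h _ _ (f.mem_graph ⟨x, hx⟩)
    -- The difference of the second coordinates is the projection onto `W` of the difference of the
    -- first ones, so it is no larger in norm.
    refine max_lt hxy (lt_of_le_of_lt ?_ hxy)
    rw [dist_eq_norm, dist_eq_norm]
    refine norm_le_of_mem_of_sub_mem_orthogonal (A := A) (W.sub_mem hw hz) ?_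
    rw [sub_sub_sub_comm]
    exact Submodule.sub_mem _ hyw hxz
  · rw [← hfc.graph_closure_eq_closure_graph]
    exact Submodule.topologicalClosure_minimal _ hfa (adjoint_isClosed hf)

/-- A densely defined operator whose adjoint equals its closure is symmetric. -/
theorem inner_eq_of_adjoint_eq_closure {f : X →ₗ.[ℂ] X} (hf : Dense (f.domain : Set X))
    (h : adjoint A f = f.closure) {x y x' y' : X} (hxy : (x, y) ∈ f.graph)
    (hxy' : (x', y') ∈ f.graph) : (inner A y x' : A) = inner A x y' := by
  refine (mem_adjoint_graph hf).mp ?_ x y hxy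
  rw [h]
  exact LinearPMap.le_graph_of_le f.le_closure hxy'

variable [CompleteSpace X] [CompleteSpace Y]

theorem IsRegular.mem_orthogonal_range_adjoint_iff (ht : IsRegular A t) {x : X} :
    x ∈ orthogonal A (LinearMap.range (adjoint A t).toFun).topologicalClosure ↔
      (x, 0) ∈ t.graph := by
  rw [orthogonal_topologicalClosure,
    HilbertModuleOperator.mem_orthogonal_range_adjoint_iff ht.graphsSpan ht.dense_domain]

theorem IsRegular.mem_pinv_graph (ht : IsRegular A t) {y : Y} {x : X} :
    (y, x) ∈ (pinv A t).graph ↔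
      x ∈ (LinearMap.range (adjoint A t).toFun).topologicalClosure ∧
        ∃ z, (x, z) ∈ t.graph ∧ y - z ∈ orthogonal A (LinearMap.range t.toFun) := by
  rw [pinv, Submodule.toLinearPMap_graph_eq, mem_pinvGraph]
  rintro ⟨y, x⟩ ⟨hx, z, hz, hyz⟩ (rfl : y = 0)
  dsimp only at hx hz hyz ⊢
  rw [zero_sub] at hyz
  have hz0 : z = 0 := by
    have := Submodule.neg_mem _ hyz
    rw [neg_neg] at this
    exact eq_zero_of_mem_of_mem_orthogonal (mem_range_iff.mpr ⟨x, hz⟩) this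
  rw [hz0] at hz
  exact eq_zero_of_mem_of_mem_orthogonal hx (ht.mem_orthogonal_range_adjoint_iff.mpr hz)

theorem IsRegular.exists_add_ker (ht : IsRegular A t)
    (hran_adj : IsOrthogonallyComplemented A
      (LinearMap.range (adjoint A t).toFun).topologicalClosure) (x : X) :
    ∃ p ∈ (LinearMap.range (adjoint A t).toFun).topologicalClosure,
      ∃ n, (n, (0 : Y)) ∈ t.graph ∧ p + n = x := by
  obtain ⟨p, hp, n, hn, h⟩ := hran_adj.exists_add x
  exact ⟨p, hp, n, ht.mem_orthogonal_range_adjoint_iff.mp hn, h⟩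

theorem IsRegular.dense_pinv_domain (ht : IsRegular A t)
    (hran_adj : IsOrthogonallyComplemented A
      (LinearMap.range (adjoint A t).toFun).topologicalClosure)
    (hran : IsOrthogonallyComplemented A (LinearMap.range t.toFun).topologicalClosure) :
    Dense ((pinv A t).domain : Set Y) := by
  rw [pinv, Submodule.toLinearPMap_domain]
  exact dense_map_fst_pinvGraph (ht.exists_add_ker hran_adj) hran

/-- The Moore–Penrose inverse of `t*` is contained in the adjoint of that of `t`. -/
theorem IsRegular.pinvGraph_adjoint_le (ht : IsRegular A t)
    (hran_adj : IsOrthogonallyComplemented A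
      (LinearMap.range (adjoint A t).toFun).topologicalClosure)
    (hran : IsOrthogonallyComplemented A (LinearMap.range t.toFun).topologicalClosure) :
    pinvGraph A (adjoint A t) (LinearMap.range t.toFun).topologicalClosure ≤
      (adjoint A (pinv A t)).graph := by
  rintro ⟨x', y'⟩ ⟨hy', w, hw, hxw⟩
  refine (mem_adjoint_graph (ht.dense_pinv_domain hran_adj hran)).mpr fun y x hyx => ?_
  obtain ⟨hx, z, hz, hyz⟩ := ht.mem_pinv_graph.mp hyx
  rw [← orthogonal_topologicalClosure] at hxw hyz
  rw [inner_eq_of_sub_mem_orthogonal hx hxw, ← (mem_adjoint_graph ht.dense_domain).mp hw x z hz]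
  exact (inner_comm_eq (inner_eq_of_sub_mem_orthogonal hy' hyz)).symm

/-- Decompose the components `(v₁, u₁)` in the two closed ranges by the graphs of `t` and `t*`. Then
`x = v₁ + w` and `y = u₁ - z` stay in these closures, so `t† (z + u₀) = x` and `(t†)* (v₀ - w) =
-y`. -/
theorem IsRegular.graphsSpan_pinv (ht : IsRegular A t)
    (hran_adj : IsOrthogonallyComplemented A
      (LinearMap.range (adjoint A t).toFun).topologicalClosure)
    (hran : IsOrthogonallyComplemented A (LinearMap.range t.toFun).topologicalClosure) :
    GraphsSpan A (pinv A t) := by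
  intro u v
  obtain ⟨u₁, hu₁, u₀, hu₀, rfl⟩ := hran.exists_add u
  obtain ⟨v₁, hv₁, v₀, hv₀, rfl⟩ := hran_adj.exists_add v
  obtain ⟨x, z, y, w, hxz, hyw, hv, hu⟩ := ht.graphsSpan v₁ u₁
  have hx : x ∈ (LinearMap.range (adjoint A t).toFun).topologicalClosure := by
    rw [← sub_add_cancel x w, ← hv]
    exact Submodule.add_mem _ hv₁ (Submodule.le_topologicalClosure _ (mem_range_iff.mpr ⟨y, hyw⟩))
  have hy : y ∈ (LinearMap.range t.toFun).topologicalClosure := by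
    rw [← add_sub_cancel_left z y, ← hu]
    exact Submodule.sub_mem _ hu₁ (Submodule.le_topologicalClosure _ (mem_range_iff.mpr ⟨x, hxz⟩))
  rw [orthogonal_topologicalClosure] at hu₀ hv₀
  refine ⟨z + u₀, x, v₀ - w, -y, ht.mem_pinv_graph.mpr ⟨hx, z, hxz, ?_⟩,
    ht.pinvGraph_adjoint_le hran_adj hran (mem_pinvGraph.mpr
      ⟨Submodule.neg_mem _ hy, -w, (adjoint A t).graph.neg_mem hyw, ?_⟩), ?_, ?_⟩
  · rwa [add_sub_cancel_left]
  · rwa [sub_neg_eq_add, sub_add_cancel]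
  · rw [hu]
    abel
  · rw [hv]
    abel

theorem IsRegular.isModuleLinear_pinv (ht : IsRegular A t)
    (hran_adj : IsOrthogonallyComplemented A
      (LinearMap.range (adjoint A t).toFun).topologicalClosure) :
    IsModuleLinear A (pinv A t) := by
  refine isModuleLinear_iff.mpr fun a y x hyx => ?_
  obtain ⟨hx, z, hz, hyz⟩ := ht.mem_pinv_graph.mp hyx
  -- Testing against the orthogonal complement shows that the closure of `Ran t*` is stable under
  -- `A`, with no appeal to `A`-linearity of `t*`.
  refine ht.mem_pinv_graph.mpr ⟨hran_adj.mem_of_inner_eq_zero fun n hn => ?_, a • z,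
    isModuleLinear_iff.mp ht.moduleLinear a x z hz, fun w hw => ?_⟩
  · rw [CStarModule.inner_op_smul_right, inner_eq_zero_of_mem_orthogonal hx hn, mul_zero]
  · rw [CStarModule.inner_sub_right, CStarModule.inner_op_smul_right,
      CStarModule.inner_op_smul_right, inner_eq_of_sub_mem_orthogonal hw hyz, sub_self]

theorem IsRegular.pinv (ht : IsRegular A t)
    (hran_adj : IsOrthogonallyComplemented A
      (LinearMap.range (adjoint A t).toFun).topologicalClosure)
    (hran : IsOrthogonallyComplemented A (LinearMap.range t.toFun).topologicalClosure) :
    IsRegular A (pinv A t) := by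
  refine (ht.graphsSpan_pinv hran_adj hran).isRegular (ht.isModuleLinear_pinv hran_adj)
    (ht.dense_pinv_domain hran_adj hran) ?_
  have h1 : (pinvGraph A (adjoint A t) (LinearMap.range t.toFun).topologicalClosure).map
      (LinearMap.fst ℂ X Y) ≤ (adjoint A (HilbertModuleOperator.pinv A t)).domain := by
    refine le_trans ?_ (LinearPMap.graph_map_fst_eq_domain _).le
    exact Submodule.map_mono (ht.pinvGraph_adjoint_le hran_adj hran)
  refine (dense_map_fst_pinvGraph (fun y => ?_) hran_adj).mono h1
  obtain ⟨q, hq, k, hk, h⟩ := hran.exists_add y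
  exact ⟨q, hq, k, ht.mem_orthogonal_range_iff.mp hk, h⟩

end Regular

/-! ### Moore–Penrose identities, uniqueness and commutation -/

section MoorePenrose

variable [CompleteSpace X] [CompleteSpace Y] {t : X →ₗ.[ℂ] Y}

/-- If `(x, z)` is in the graph of `t` and `x = p + n` with `p` in the closure of `Ran t*` and
`n ∈ Ker t`, then `t† z = p`. -/
theorem IsRegular.exists_mem_pinv_graph (ht : IsRegular A t)
    (hran_adj : IsOrthogonallyComplemented A
      (LinearMap.range (adjoint A t).toFun).topologicalClosure) {x : X} {z : Y}
    (hxz : (x, z) ∈ t.graph) : ∃ p, (z, p) ∈ (HilbertModuleOperator.pinv A t).graph ∧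
      (p, z) ∈ t.graph := by
  obtain ⟨p, hp, n, hn, rfl⟩ := ht.exists_add_ker hran_adj x
  have hpz : (p, z) ∈ t.graph := by
    simpa only [Prod.mk_sub_mk, add_sub_cancel_right, sub_zero] using t.graph.sub_mem hxz hn
  refine ⟨p, ht.mem_pinv_graph.mpr ⟨hp, z, hpz, ?_⟩, hpz⟩
  rw [sub_self]
  exact Submodule.zero_mem _

theorem IsRegular.isMoorePenroseInverse_pinv (ht : IsRegular A t)
    (hran_adj : IsOrthogonallyComplemented A
      (LinearMap.range (adjoint A t).toFun).topologicalClosure)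
    (hran : IsOrthogonallyComplemented A (LinearMap.range t.toFun).topologicalClosure) :
    IsMoorePenroseInverse A t (HilbertModuleOperator.pinv A t) where
  regular := ht.pinv hran_adj hran
  mul_mul_self := by
    refine (LinearPMap.eq_of_eq_graph (le_antisymm ?_ ?_)).symm
    · rintro ⟨x, z⟩ hxz
      obtain ⟨p, h1, h2⟩ := ht.exists_mem_pinv_graph hran_adj hxz
      exact mem_mulOp_graph.mpr ⟨p, mem_mulOp_graph.mpr ⟨z, hxz, h1⟩, h2⟩
    · rintro ⟨x, z'⟩ hxz
      obtain ⟨p', h3, h4⟩ := mem_mulOp_graph.mp hxz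
      obtain ⟨z, hxz, h5⟩ := mem_mulOp_graph.mp h3
      obtain ⟨p, h1, h2⟩ := ht.exists_mem_pinv_graph hran_adj hxz
      rw [LinearPMap.mem_graph_snd_inj _ h5 h1 rfl] at h4
      rwa [LinearPMap.mem_graph_snd_inj _ h4 h2 rfl]
  self_mul_mul := by
    refine (LinearPMap.eq_of_eq_graph (le_antisymm ?_ ?_)).symm
    · rintro ⟨y, x⟩ hyx
      obtain ⟨hx, z, hz, -⟩ := ht.mem_pinv_graph.mp hyx
      refine mem_mulOp_graph.mpr ⟨z, mem_mulOp_graph.mpr ⟨x, hyx, hz⟩,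
        ht.mem_pinv_graph.mpr ⟨hx, z, hz, ?_⟩⟩
      rw [sub_self]
      exact Submodule.zero_mem _
    · rintro ⟨y, x'⟩ hyx
      obtain ⟨z', h3, h4⟩ := mem_mulOp_graph.mp hyx
      obtain ⟨x, hyx, h5⟩ := mem_mulOp_graph.mp h3
      obtain ⟨hx, z, hz, -⟩ := ht.mem_pinv_graph.mp hyx
      rw [LinearPMap.mem_graph_snd_inj _ h5 hz rfl] at h4
      have h6 : (z, x) ∈ (HilbertModuleOperator.pinv A t).graph := by
        refine ht.mem_pinv_graph.mpr ⟨hx, z, hz, ?_⟩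
        rw [sub_self]
        exact Submodule.zero_mem _
      rwa [LinearPMap.mem_graph_snd_inj _ h4 h6 rfl]
  adjoint_left := by
    refine adjoint_eq_closure_of_projection hran
      ((ht.dense_pinv_domain hran_adj hran).mono fun y hy => ?_) fun y z' hyz => ?_
    · obtain ⟨x, hyx⟩ := LinearPMap.mem_domain_iff.mp hy
      obtain ⟨-, z, hz, -⟩ := ht.mem_pinv_graph.mp hyx
      exact LinearPMap.mem_domain_iff.mpr ⟨z, mem_mulOp_graph.mpr ⟨x, hyx, hz⟩⟩
    · obtain ⟨x, hyx, hxz'⟩ := mem_mulOp_graph.mp hyz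
      obtain ⟨-, z, hz, hyz⟩ := ht.mem_pinv_graph.mp hyx
      rw [orthogonal_topologicalClosure, LinearPMap.mem_graph_snd_inj _ hxz' hz rfl]
      exact ⟨Submodule.le_topologicalClosure _ (mem_range_iff.mpr ⟨x, hz⟩), hyz⟩
  adjoint_right := by
    refine adjoint_eq_closure_of_projection hran_adj
      (ht.dense_domain.mono fun x hx => ?_) fun x p' hxp => ?_
    · obtain ⟨z, hxz⟩ := LinearPMap.mem_domain_iff.mp hx
      obtain ⟨p, h1, -⟩ := ht.exists_mem_pinv_graph hran_adj hxz
      exact LinearPMap.mem_domain_iff.mpr ⟨p, mem_mulOp_graph.mpr ⟨z, hxz, h1⟩⟩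
    · obtain ⟨z, hxz, hzp'⟩ := mem_mulOp_graph.mp hxp
      obtain ⟨p, h1, h2⟩ := ht.exists_mem_pinv_graph hran_adj hxz
      rw [LinearPMap.mem_graph_snd_inj _ hzp' h1 rfl]
      refine ⟨(ht.mem_pinv_graph.mp h1).1, ht.mem_orthogonal_range_adjoint_iff.mpr ?_⟩
      simpa only [Prod.mk_sub_mk, sub_self] using t.graph.sub_mem hxz h2

/-- Let `x = s y`, so `x = s t x`. Symmetry of `s t` makes `x` orthogonal to `Ker t`, hence in the
closure of `Ran t*`. Symmetry of `t s`, which fixes `Ran t`, makes `y - t s y` orthogonal to `Ran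
t`. -/
theorem IsMoorePenroseInverse.le_pinv {s : Y →ₗ.[ℂ] X} (hs : IsMoorePenroseInverse A t s)
    (ht : IsRegular A t) (hran_adj : IsOrthogonallyComplemented A
      (LinearMap.range (adjoint A t).toFun).topologicalClosure) :
    s.graph ≤ (HilbertModuleOperator.pinv A t).graph := by
  rintro ⟨y, x⟩ hyx
  obtain ⟨z, hxz, hzx⟩ := hs.mul_mem_graph hyx
  refine ht.mem_pinv_graph.mpr ⟨hran_adj.mem_of_inner_eq_zero fun n hn => ?_, z, hxz, ?_⟩
  · have hn' : (n, (0 : X)) ∈ (mulOp s t).graph := mem_mulOp_graph.mpr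
      ⟨0, ht.mem_orthogonal_range_adjoint_iff.mp hn, s.graph.zero_mem⟩
    rw [← inner_eq_of_adjoint_eq_closure (hs.dense_domain_right ht.dense_domain) hs.adjoint_right
      hn' (mem_mulOp_graph.mpr ⟨z, hxz, hzx⟩), CStarModule.inner_zero_left]
  · intro w hw
    obtain ⟨x', hx'w⟩ := mem_range_iff.mp hw
    obtain ⟨p, h1, h2⟩ := hs.mem_graph_mul hx'w
    rw [CStarModule.inner_sub_right, inner_eq_of_adjoint_eq_closure hs.dense_domain_left
      hs.adjoint_left (mem_mulOp_graph.mpr ⟨p, h1, h2⟩) (mem_mulOp_graph.mpr ⟨x, hyx, hxz⟩),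
      sub_self]

/-- Since `(t s)* k = 0`, the pair `(k, 0)` lies in the closure of the graph of `t s`. On that graph
`s (y - t s y) = 0`, and `s` is closed, so this passes to the limit. Symmetry of `t s` alone would
not put `k` in `Dom s`. -/
theorem IsMoorePenroseInverse.mem_graph_of_mem_orthogonal {s : Y →ₗ.[ℂ] X}
    (hs : IsMoorePenroseInverse A t s) {k : Y}
    (hk : k ∈ orthogonal A (LinearMap.range t.toFun)) : (k, 0) ∈ s.graph := by
  have h1 : (k, (0 : Y)) ∈ (mulOp t s).closure.graph := by
    rw [← hs.adjoint_left, mem_adjoint_graph hs.dense_domain_left]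
    intro y z hyz
    obtain ⟨x, -, hxz⟩ := mem_mulOp_graph.mp hyz
    rw [hk z (mem_range_iff.mpr ⟨x, hxz⟩), CStarModule.inner_zero_right]
  have h2 : (mulOp t s).closure.graph ≤ (mulOp t s).graph.topologicalClosure := by
    -- For a non-closable operator `closure` returns the operator itself, so the inclusion holds in
    -- both cases.
    by_cases hc : (mulOp t s).IsClosable
    · exact hc.graph_closure_eq_closure_graph.ge
    · rw [LinearPMap.closure_def' hc]
      exact Submodule.le_topologicalClosure _
  have hcl : IsClosed {p : Y × Y | (p.1 - p.2, (0 : X)) ∈ s.graph} :=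
    IsClosed.preimage (f := fun p : Y × Y => (p.1 - p.2, (0 : X))) (by fun_prop)
      hs.regular.closed
  have hsub : ((mulOp t s).graph : Set (Y × Y)) ⊆ {p | (p.1 - p.2, (0 : X)) ∈ s.graph} := by
    rintro ⟨y, z⟩ hyz
    obtain ⟨x, hyx, hxz⟩ := mem_mulOp_graph.mp hyz
    obtain ⟨z', hxz', hzx⟩ := hs.mul_mem_graph hyx
    rw [← LinearPMap.mem_graph_snd_inj _ hxz hxz' rfl] at hzx
    have h3 := s.graph.sub_mem hyx hzx
    rwa [Prod.mk_sub_mk, sub_self] at h3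
  have h3 : (k - 0, (0 : X)) ∈ s.graph := closure_minimal hsub hcl (h2 h1)
  rwa [sub_zero] at h3

/-- As `s ⊆ t†`, only the domains matter: `Dom s` contains `Ran t` and `Ran(t)^⊥`, whose sum
contains `Dom t†`. -/
theorem IsMoorePenroseInverse.eq_pinv {s : Y →ₗ.[ℂ] X} (hs : IsMoorePenroseInverse A t s)
    (ht : IsRegular A t) (hran_adj : IsOrthogonallyComplemented A
      (LinearMap.range (adjoint A t).toFun).topologicalClosure) :
    s = HilbertModuleOperator.pinv A t := by
  refine LinearPMap.eq_of_eq_graph (le_antisymm (hs.le_pinv ht hran_adj) ?_)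
  rintro ⟨y, x⟩ hyx
  obtain ⟨-, z, hxz, hyz⟩ := ht.mem_pinv_graph.mp hyx
  obtain ⟨p, h1, -⟩ := hs.mem_graph_mul hxz
  have h2 : (y, p) ∈ s.graph := by
    simpa only [Prod.mk_add_mk, add_sub_cancel, add_zero] using
      s.graph.add_mem h1 (hs.mem_graph_of_mem_orthogonal hyz)
  rwa [LinearPMap.mem_graph_snd_inj _ hyx (hs.le_pinv ht hran_adj h2) rfl]

/-- Commuting with `t*` makes `S` preserve the closure of `Ran t*` and also `Ker t* = Ran(t)^⊥`;
commuting with `t` preserves the pair `(x, t x)`. -/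
theorem IsRegular.commutes_pinv {t : X →ₗ.[ℂ] X} (ht : IsRegular A t) {S : X →L[ℂ] X}
    (hSt : Commutes S t) (hSt_adj : Commutes S (adjoint A t)) :
    Commutes S (HilbertModuleOperator.pinv A t) := by
  rw [commutes_iff] at hSt hSt_adj ⊢
  intro y x hyx
  obtain ⟨hx, z, hxz, hyz⟩ := ht.mem_pinv_graph.mp hyx
  refine ht.mem_pinv_graph.mpr ⟨?_, S z, hSt x z hxz, ?_⟩
  · refine map_mem_closure S.continuous hx fun w hw => ?_
    obtain ⟨v, hv⟩ := mem_range_iff.mp hw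
    exact mem_range_iff.mpr ⟨S v, hSt_adj v w hv⟩
  · rw [HilbertModuleOperator.mem_orthogonal_range_iff ht.dense_domain] at hyz ⊢
    simpa only [map_sub, map_zero] using hSt_adj _ _ hyz

end MoorePenrose

end Pinv

end HilbertModuleOperator

theorem theorem2p6 {A X : Type*}
    [NonUnitalCStarAlgebra A] [PartialOrder A] [StarOrderedRing A]
    [NormedAddCommGroup X] [NormedSpace ℂ X] [CompleteSpace X] [SMul A X] [CStarModule A X]
    (t : X →ₗ.[ℂ] X) (ht : HilbertModuleOperator.IsRegular A t)
    (hran_adj : HilbertModuleOperator.IsOrthogonallyComplemented A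
      (LinearMap.range (HilbertModuleOperator.adjoint A t).toFun).topologicalClosure)
    (hran : HilbertModuleOperator.IsOrthogonallyComplemented A
      (LinearMap.range t.toFun).topologicalClosure)
    (S : X →L[ℂ] X) (hS : HilbertModuleOperator.IsAdjointable A S)
    (hSt : HilbertModuleOperator.Commutes S t)
    (hSt_adj : HilbertModuleOperator.Commutes S (HilbertModuleOperator.adjoint A t)) :
    ∃ t_dag : X →ₗ.[ℂ] X,
      HilbertModuleOperator.IsMoorePenroseInverse A t t_dag ∧
      (∀ s : X →ₗ.[ℂ] X, HilbertModuleOperator.IsMoorePenroseInverse A t s → s = t_dag) ∧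
      HilbertModuleOperator.mulOp (HilbertModuleOperator.ofBounded S) t_dag ≤
        HilbertModuleOperator.mulOp t_dag (HilbertModuleOperator.ofBounded S) := by
  exact ⟨HilbertModuleOperator.pinv A t, ht.isMoorePenroseInverse_pinv hran_adj hran,
    fun s hs => hs.eq_pinv ht hran_adj, ht.commutes_pinv hSt hSt_adj⟩
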